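/- Let $d\ge 2$ and let $T\colon\mathbb T^d\to\mathbb T^d$, $\mathbb T=\mathbb R/\mathbb Z$, be a skew-translation $T\mathbf x=\mathbf xA+\mathbf b$ (points are row vectors), where $A\neq \mathrm{Id}$ is an upper-triangular $d\times d$ integer matrix with ones on the diagonal and $\mathbf b\in\mathbb T^d$. Assume that $T$ is ergodic with respect to the Lebesgue measure $\lambda_d$ on $\mathbb T^d$. Let $E_j\subseteq\mathbb R^d$ denote the image of the linear map $\mathbf v\mapsto \mathbf v(A-\mathrm{Id})^j$ on row vectors, and let $k$ be such that $E_k\neq\{0\}=E_{k+1}$. Assume that $\dim E_k=1$ and that the coordinates are adapted to this filtration in the sense that $E_k=\mathbb R\,\mathbf e_d$, where $\mathbf e_d$ is the last vector of the standard basis. Let $\Psi^\perp\colon\mathbb T^d\to\mathbb K$, with $\mathbb K=\mathbb R$ or $\mathbb K=\mathbb C$, be a trigonometric polynomial, i.e. a finite sum $\sum_{\mathbf l\in\mathbb Z^d}c_{\mathbf l}e^{2\pi i\,\mathbf l\cdot\mathbf x}$ with $c_{\mathbf l}\in\mathbb C$, such that $\int_0^1\Psi^\perp(x_1,\dots,x_d)\,dx_d=0$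 for all $x_1,\dots,x_{d-1}$. Assume that $\Psi^\perp$ is not a measurable coboundary for $T$, i.e. there is no measurable $u\colon\mathbb T^d\to\mathbb K$ with $\Psi^\perp=u\circ T-u$ almost everywhere. Then, for every $C>1$, $$\lim_{n\to\infty}\lambda_d\bigl(\{\mathbf x\in\mathbb T^d: |S_n(\Psi^\perp)(\mathbf x)|<C\}\bigr)=0,\qquad\text{where } S_n(\Psi^\perp)=\sum_{i=0}^{n-1}\Psi^\perp\circ T^i .$$ -/

import Mathlib

open MeasureTheory Filter Topology

/-- The affine map `T x = x A + b` of the torus `(ℝ/ℤ)^d`, where points are row vectors and `A` is an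
integer matrix: the `j`-th coordinate of `T x` is `∑ i, a_{i,j} x_i + b_j`. -/
noncomputable def skewTranslation {d : ℕ} (A : Matrix (Fin d) (Fin d) ℤ)
    (b : UnitAddTorus (Fin d)) (x : UnitAddTorus (Fin d)) : UnitAddTorus (Fin d) :=
  fun j => (∑ i, A i j • x i) + b j

/-- Upper-triangular matrices with ones on the diagonal. -/
def IsUpperUnipotent {d : ℕ} (A : Matrix (Fin d) (Fin d) ℤ) : Prop :=
  (∀ i j, j < i → A i j = 0) ∧ ∀ i, A i i = 1

/-- The subspace `E_j` of `ℝ^d`: the image of `(A - Id)^j` acting on real row vectors,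
`v ↦ v (A - Id)^j`. -/
noncomputable def imageFiltration {d : ℕ} (A : Matrix (Fin d) (Fin d) ℤ) (j : ℕ) :
    Submodule ℝ (Fin d → ℝ) :=
  LinearMap.range (Matrix.vecMulLinear ((A.map (Int.cast : ℤ → ℝ) - 1) ^ j))

/-- The index of the last coordinate `x_d`. -/
def lastIndex {d : ℕ} (hd : 2 ≤ d) : Fin d := ⟨d - 1, by omega⟩

/-- Trigonometric polynomials on the torus with values in `𝕜 = ℝ` or `ℂ`: finite sums
`∑_l c_l e(l · x)` over `l ∈ ℤ^d` with complex coefficients `c_l`. The map `RCLike.map 𝕜 ℂ` is the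
inclusion of `𝕜` in `ℂ`. -/
def IsTrigPolynomial {𝕜 : Type*} [RCLike 𝕜] {d : ℕ} (Ψ : UnitAddTorus (Fin d) → 𝕜) : Prop :=
  ∃ c : (Fin d → ℤ) →₀ ℂ, ∀ x,
    RCLike.map 𝕜 ℂ (Ψ x) = c.sum fun l a => a * UnitAddTorus.mFourier l x

/-- The integral of `Ψ` over the coordinate `x_i` vanishes identically in the other coordinates. -/
def HasZeroAverage {𝕜 : Type*} [RCLike 𝕜] {d : ℕ} (i : Fin d)
    (Ψ : UnitAddTorus (Fin d) → 𝕜) : Prop :=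
  ∀ x, ∫ y : UnitAddCircle, Ψ (Function.update x i y) = 0

/-- `Ψ` is a measurable coboundary for `T`: `Ψ = u ∘ T - u` almost everywhere, for some measurable
function `u`. -/
def IsMeasurableCoboundary {𝕜 : Type*} [RCLike 𝕜] {d : ℕ}
    (T : UnitAddTorus (Fin d) → UnitAddTorus (Fin d)) (Ψ : UnitAddTorus (Fin d) → 𝕜) : Prop :=
  ∃ u : UnitAddTorus (Fin d) → 𝕜, Measurable u ∧ ∀ᵐ x, Ψ x = u (T x) - u x

/-! Write `F` for `Ψ` viewed in `ℂ`, `S_m` for its Birkhoff sums, `e = e_d`, and `a` for the measure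
of `B = {|S_n F| < C}`. Two Cauchy–Schwarz arguments bound `a`. In time: on `B ∩ T⁻ᵐ B` the cocycle
identity gives `|S_m F ∘ Tⁿ - S_m F| < 2C`, so `a²` is at most twice the average over `m < M` of the
measures `D_m` of these sets. In space: since `e` lies in the image of `(A - 1)^k` and `k > 0`, tiny
translations are sheared by `Tⁿ` into the translation by any `t e`. For large `n` this allows
replacing `Tⁿ x` by `Tⁿ x + iθe` for all `i < Q` at once. Comparing `i` with `j` bounds `D_m²` by
the average over `i, j` of the measures of `{|S_m F_q| < 6C}`, where `q = i - j` and `F_q = F(· +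
qθe) - F`. For irrational `θ` and `q ≠ 0`, `F_q` is not a coboundary
(`isMeasurableCoboundary_of_translate_sub`), so the mean ergodic theorem on `X × ℝ` makes these
measures tend to `0` on average in `m`. Only the diagonal, of proportion `1/Q`, remains. -/

open scoped ENNReal

/-! ### Ergodic maps: sums of a non-coboundary are small only rarely. -/

/-- An integrable nonzero density on `X × ℝ` invariant under the skew product of an ergodic map `T` by
`ψ` forces `ψ` to be a coboundary: the fibrewise medians form a transfer function. -/
theorem Ergodic.exists_transfer_of_invariant_density {X : Type*} [MeasurableSpace X] {μ : Measure X}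
    {T : X → X} (hT : Ergodic T μ) {ψ : X → ℝ}
    {g : X × ℝ → ℝ≥0∞} (hg : Measurable g) (hint : ∫⁻ p, g p ∂(μ.prod volume) ≠ ∞)
    (hne : ¬ g =ᵐ[μ.prod volume] 0)
    (hinv : ∀ᵐ p ∂(μ.prod volume), g (T p.1, p.2 + ψ p.1) = g p) :
    ∃ u : X → ℝ, Measurable u ∧ ∀ᵐ x ∂μ, ψ x = u (T x) - u x := by
  classical
  set ρ : X → ℝ≥0∞ := fun x => ∫⁻ z, g (x, z) with hρ
  set G : X → ℝ → ℝ≥0∞ := fun x t => ∫⁻ z in Set.Iic t, g (x, z) with hG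
  have hρm : Measurable ρ := hg.lintegral_prod_right'
  have hGm : ∀ t, Measurable fun x => G x t := fun t =>
    (hg.lintegral_prod_right' (ν := volume.restrict (Set.Iic t)))
  have hslice : ∀ᵐ x ∂μ, ∀ᵐ z : ℝ, g (T x, z + ψ x) = g (x, z) :=
    Measure.ae_ae_of_ae_prod hinv
  have hρinv : ρ ∘ T =ᵐ[μ] ρ := by
    filter_upwards [hslice] with x hx
    calc ρ (T x) = ∫⁻ z, g (T x, z + ψ x) :=
          (lintegral_add_right_eq_self (fun z => g (T x, z)) (ψ x)).symm
      _ = ρ x := lintegral_congr_ae hx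
  have hGinv : ∀ᵐ x ∂μ, ∀ t, G (T x) (t + ψ x) = G x t := by
    filter_upwards [hslice] with x hx t
    simp only [hG]
    rw [← lintegral_indicator measurableSet_Iic, ← lintegral_indicator measurableSet_Iic,
      ← lintegral_add_right_eq_self _ (ψ x)]
    refine lintegral_congr_ae ?_
    filter_upwards [hx] with z hz
    simp [Set.indicator_apply, hz]
  -- `ρ` is the mass of a fibre and `G x` its distribution function. By ergodicity almost all fibres
  -- have the same mass, which is neither `0` nor `∞`.
  obtain ⟨c, hc⟩ := hT.ae_eq_const_of_ae_eq_comp_ae hρm.aestronglyMeasurable hρinv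
  have hρint : ∫⁻ x, ρ x ∂μ ≠ ∞ := by
    rwa [hρ, ← lintegral_prod _ hg.aemeasurable]
  have hρ0 : ¬ ρ =ᵐ[μ] 0 := by
    intro h
    apply hne
    rw [← lintegral_eq_zero_iff hg, lintegral_prod _ hg.aemeasurable]
    exact (lintegral_eq_zero_iff hρm).2 h
  have hc0 : c ≠ 0 := by
    rintro rfl
    exact hρ0 hc
  have hμ0 : μ ≠ 0 := by
    rintro rfl
    exact hρ0 (by rw [ae_zero]; exact eventually_bot)
  have hct : c ≠ ∞ := by
    rintro rfl
    rw [lintegral_congr_ae hc] at hρint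
    simp [hμ0] at hρint
  have hc2 : c / 2 < c := ENNReal.half_lt_self hc0 hct
  have hc2' : 0 < c / 2 := ENNReal.half_pos hc0
  have hmono : ∀ x, Monotone (G x) := fun x s t hst =>
    lintegral_mono_set (Set.Iic_subset_Iic.2 hst)
  have hGν : ∀ x t, G x t = volume.withDensity (fun z => g (x, z)) (Set.Iic t) := fun x t =>
    (withDensity_apply _ measurableSet_Iic).symm
  have hnonempty : ∀ x, ρ x = c → {t | c / 2 ≤ G x t}.Nonempty := by
    intro x hx
    have h := tendsto_measure_Iic_atTop (volume.withDensity (fun z => g (x, z)))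
    simp only [← hGν] at h
    rw [withDensity_apply _ MeasurableSet.univ, Measure.restrict_univ] at h
    obtain ⟨t, ht⟩ := (h.eventually_const_lt (hc2.trans_eq hx.symm)).exists
    exact ⟨t, ht.le⟩
  have hbdd : ∀ x, ρ x = c → BddBelow {t | c / 2 ≤ G x t} := by
    intro x hx
    have : IsFiniteMeasure (volume.withDensity (fun z => g (x, z))) :=
      isFiniteMeasure_withDensity (hx.trans_ne hct)
    have h := tendsto_measure_iInter_atBot (μ := volume.withDensity (fun z => g (x, z)))
      (s := Set.Iic) (fun _ => measurableSet_Iic.nullMeasurableSet) monotone_Iic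
      ⟨0, measure_ne_top _ _⟩
    have hempty : ⋂ t : ℝ, Set.Iic t = ∅ := by
      refine Set.eq_empty_of_forall_notMem fun z hz => ?_
      have := Set.mem_iInter.1 hz (z - 1)
      simp at this
      linarith
    rw [hempty, measure_empty] at h
    simp only [Function.comp_def, ← hGν] at h
    obtain ⟨t, ht⟩ := (h.eventually_lt_const hc2').exists
    refine ⟨t, fun s hs => ?_⟩
    by_contra! hst
    exact absurd (hs.trans (hmono x hst.le)) (not_le.2 ht)
  refine ⟨fun x => if ρ x = c then sInf {t | c / 2 ≤ G x t} else 0, ?_, ?_⟩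
  · refine measurable_of_Iio fun a => ?_
    -- Monotonicity of `G x` lets rational thresholds detect whether the median is below `a`,
    -- leaving a countable union.
    have hset : (fun x => if ρ x = c then sInf {t | c / 2 ≤ G x t} else 0) ⁻¹' Set.Iio a =
        ({x | ρ x = c} ∩ ⋃ q : {q : ℚ // (q : ℝ) < a}, {x | c / 2 ≤ G x q}) ∪
          ({x | ρ x = c}ᶜ ∩ {x | (0 : ℝ) < a}) := by
      ext x
      by_cases hx : ρ x = c
      · simp only [Set.mem_preimage, hx, if_true, Set.mem_Iio, Set.mem_union, Set.mem_inter_iff,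
          Set.mem_ofPred_eq, true_and, Set.mem_compl_iff, not_true, false_and, or_false,
          Set.mem_iUnion]
        rw [csInf_lt_iff (hbdd x hx) (hnonempty x hx)]
        constructor
        · rintro ⟨t, ht, hta⟩
          obtain ⟨q, hq, hqa⟩ := exists_rat_btwn hta
          exact ⟨⟨q, hqa⟩, ht.trans (hmono x hq.le)⟩
        · rintro ⟨q, hq⟩
          exact ⟨q, hq, q.2⟩
      · simp [hx]
    rw [hset]
    refine MeasurableSet.union (MeasurableSet.inter (measurableSet_eq_fun hρm measurable_const)
      (MeasurableSet.iUnion fun q => measurableSet_le measurable_const (hGm q)))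
      (MeasurableSet.inter (measurableSet_eq_fun hρm measurable_const).compl (MeasurableSet.const _))
  · filter_upwards [hc, hρinv, hGinv] with x hx hx' hGx
    have h1 : ρ x = c := hx
    have h2 : ρ (T x) = c := hx'.trans h1
    simp only [h1, h2, if_true]
    have hset : {t | c / 2 ≤ G (T x) t} = (OrderIso.addRight (ψ x)) '' {t | c / 2 ≤ G x t} := by
      ext t
      simp only [Set.mem_ofPred_eq, Set.mem_image, OrderIso.addRight_apply]
      constructor
      · intro ht
        refine ⟨t - ψ x, ?_, by ring⟩
        rwa [← hGx, sub_add_cancel]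
      · rintro ⟨s, hs, rfl⟩
        rwa [hGx]
    have h := OrderIso.map_csInf' (OrderIso.addRight (ψ x)) (hnonempty x h1) (hbdd x h1)
    rw [hset, ← h]
    simp

/-- If the real function `ψ` is not a measurable coboundary of the ergodic map `T`, then its Birkhoff
sums leave every bounded interval along a set of times of density one, in measure. -/
theorem Ergodic.tendsto_average_measureReal_birkhoffSum_lt {X : Type*} [MeasurableSpace X]
    {μ : Measure X} [IsProbabilityMeasure μ] {T : X → X} (hT : Ergodic T μ) {ψ : X → ℝ}
    (hψ : Measurable ψ)
    (hcob : ¬ ∃ u : X → ℝ, Measurable u ∧ ∀ᵐ x ∂μ, ψ x = u (T x) - u x) {R : ℝ} (hR : 0 < R) :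
    Tendsto (fun M : ℕ => (M : ℝ)⁻¹ *
      ∑ m ∈ Finset.range M, μ.real {x | |birkhoffSum T ψ m x| < R}) atTop (𝓝 0) := by
  set ν := μ.prod (volume : Measure ℝ) with hν
  set Φ : X × ℝ → X × ℝ := fun p => (T p.1, p.2 + ψ p.1) with hΦdef
  have hΦ : MeasurePreserving Φ ν ν :=
    hT.toMeasurePreserving.skew_product (g := fun x z => z + ψ x)
      (by simp only [Function.uncurry_def]; fun_prop)
      (Eventually.of_forall fun x => map_add_right_eq_self _ _)
  have hΦiter : ∀ m p, Φ^[m] p = (T^[m] p.1, p.2 + birkhoffSum T ψ m p.1) := by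
    intro m
    induction m with
    | zero => intro p; simp
    | succ m ih =>
      intro p
      rw [Function.iterate_succ_apply', ih, Function.iterate_succ_apply', birkhoffSum_succ]
      simp [hΦdef, add_assoc]
  -- The strip has half-width `2R`: if `|z| < R` and `|S_m| < R` then `z` and `z + S_m` both lie in
  -- it, which gives the lower bound `hlow`.
  set E : Set (X × ℝ) := Set.univ ×ˢ Set.Ioo (-(2 * R)) (2 * R) with hE
  have hEm : MeasurableSet E := MeasurableSet.univ.prod measurableSet_Ioo
  have hEfin : ν E ≠ ∞ := by
    rw [hE, hν, Measure.prod_prod]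
    simp
  set χ := indicatorConstLp 2 hEm hEfin (1 : ℝ) with hχ
  set U := (Lp.compMeasurePreservingₗᵢ ℝ (E := ℝ) (p := 2) Φ hΦ).toContinuousLinearMap with hU
  have hfin : ∀ m, ν (Φ^[m] ⁻¹' E) ≠ ∞ := fun m => by
    rwa [(hΦ.iterate m).measure_preimage hEm.nullMeasurableSet]
  have hUiter : ∀ m, U^[m] χ = indicatorConstLp 2 ((hΦ.iterate m).measurable hEm) (hfin m) (1 : ℝ) := by
    intro m
    induction m with
    | zero => rfl
    | succ m ih =>
      rw [Function.iterate_succ_apply', ih]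
      exact (Lp.indicatorConstLp_compMeasurePreserving ..)
  have hfix : ∀ y : Lp ℝ 2 ν, U y = y → y = 0 := by
    intro y hy
    by_contra hne
    -- A nonzero fixed vector `y` in `L²` would give the invariant integrable density `|y|²`. Hence
    -- the mean ergodic limit of `χ` is `0`.
    refine hcob (hT.exists_transfer_of_invariant_density (g := fun p => ‖y p‖ₑ ^ (2 : ℝ)) ?_ ?_ ?_ ?_)
    · exact (Lp.stronglyMeasurable y).measurable.enorm.pow_const _
    · have := lintegral_rpow_enorm_lt_top_of_eLpNorm_lt_top (by norm_num) (by norm_num) (Lp.eLpNorm_lt_top y)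
      simpa using this.ne
    · intro h
      refine hne ((Lp.eq_zero_iff_ae_eq_zero).2 ?_)
      filter_upwards [h] with p hp
      simpa using hp
    · have h1 : (U y : X × ℝ → ℝ) =ᵐ[ν] y ∘ Φ := Lp.coeFn_compMeasurePreserving y hΦ
      rw [hy] at h1
      filter_upwards [h1] with p hp
      rw [hp]
      rfl
  have hlim := U.tendsto_birkhoffAverage_orthogonalProjection
    (LinearIsometry.norm_toContinuousLinearMap_le _) χ
  have hproj : ((U.eqLocus (1 : Lp ℝ 2 ν →L[ℝ] Lp ℝ 2 ν)).orthogonalProjectionOnto χ : Lp ℝ 2 ν) =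
      0 := hfix _ ((U.eqLocus (1 : Lp ℝ 2 ν →L[ℝ] Lp ℝ 2 ν)).orthogonalProjectionOnto χ).2
  rw [hproj] at hlim
  have hinner := (tendsto_const_nhds (x := χ)).inner (𝕜 := ℝ) hlim
  rw [inner_zero_right] at hinner
  have hlow : ∀ m, 2 * R * μ.real {x | |birkhoffSum T ψ m x| < R} ≤ inner ℝ χ (U^[m] χ) := by
    intro m
    rw [hUiter, hχ, L2.real_inner_indicatorConstLp_one_indicatorConstLp_one hEm _ hEfin (hfin m)]
    have : 2 * R * μ.real {x | |birkhoffSum T ψ m x| < R} =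
        ν.real ({x | |birkhoffSum T ψ m x| < R} ×ˢ Set.Ioo (-R) R) := by
      rw [hν, measureReal_prod_prod, Real.volume_real_Ioo_of_le (by linarith)]
      ring
    rw [this]
    refine measureReal_mono ?_ (measure_ne_top_of_subset Set.inter_subset_left hEfin)
    rintro ⟨x, z⟩ ⟨hx, hz⟩
    simp only [Set.mem_ofPred_eq, Set.mem_Ioo] at hx hz
    rw [abs_lt] at hx
    simp only [hE, Set.mem_inter_iff, Set.mem_preimage, hΦiter, Set.mem_prod, Set.mem_univ,
      true_and, Set.mem_Ioo]
    refine ⟨⟨?_, ?_⟩, ?_, ?_⟩ <;> linarith [hx.1, hx.2, hz.1, hz.2]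
  have hzero : Tendsto (fun M => (2 * R)⁻¹ * inner ℝ χ (birkhoffAverage ℝ U _root_.id M χ)) atTop
      (𝓝 0) := by
    simpa using hinner.const_mul (2 * R)⁻¹
  refine squeeze_zero (fun M => by positivity) (fun M => ?_) hzero
  have hR2 : 0 < 2 * R := by positivity
  have hexp : (2 * R)⁻¹ * inner ℝ χ (birkhoffAverage ℝ U _root_.id M χ) =
      (M : ℝ)⁻¹ * ∑ m ∈ Finset.range M, (2 * R)⁻¹ * inner ℝ χ (U^[m] χ) := by
    rw [birkhoffAverage, birkhoffSum, real_inner_smul_right, inner_sum, ← mul_assoc,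
      mul_comm (2 * R)⁻¹, mul_assoc, Finset.mul_sum]
    rfl
  rw [hexp]
  gcongr with m
  rw [le_inv_mul_iff₀ hR2]
  exact hlow m

/-- Complex version of `Ergodic.tendsto_average_measureReal_birkhoffSum_lt`. -/
theorem Ergodic.tendsto_average_measureReal_norm_birkhoffSum_lt {X : Type*} [MeasurableSpace X]
    {μ : Measure X} [IsProbabilityMeasure μ] {T : X → X} (hT : Ergodic T μ) {F : X → ℂ}
    (hF : Measurable F)
    (hcob : ¬ ∃ u : X → ℂ, Measurable u ∧ ∀ᵐ x ∂μ, F x = u (T x) - u x) {R : ℝ} (hR : 0 < R) :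
    Tendsto (fun M : ℕ => (M : ℝ)⁻¹ *
      ∑ m ∈ Finset.range M, μ.real {x | ‖birkhoffSum T F m x‖ < R}) atTop (𝓝 0) := by
  have key : ∀ L : ℂ →ₗ[ℝ] ℝ, Measurable L → (∀ z, |L z| ≤ ‖z‖) →
      (¬ ∃ u : X → ℝ, Measurable u ∧ ∀ᵐ x ∂μ, L (F x) = u (T x) - u x) →
      Tendsto (fun M : ℕ => (M : ℝ)⁻¹ *
        ∑ m ∈ Finset.range M, μ.real {x | ‖birkhoffSum T F m x‖ < R}) atTop (𝓝 0) := by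
    intro L hLm hL hLcob
    refine squeeze_zero (fun M => by positivity) (fun M => ?_)
      (hT.tendsto_average_measureReal_birkhoffSum_lt (hLm.comp hF) hLcob hR)
    refine mul_le_mul_of_nonneg_left (Finset.sum_le_sum fun m _ => ?_) (by positivity)
    refine measureReal_mono fun x (hx : _ < R) => ?_
    have := hL (birkhoffSum T F m x)
    rw [map_birkhoffSum] at this
    exact this.trans_lt hx
  -- If both the real and the imaginary part were coboundaries, so would be `F`; one of them falls
  -- under the real case.
  by_cases hre : ∃ u : X → ℝ, Measurable u ∧ ∀ᵐ x ∂μ, (F x).re = u (T x) - u x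
  · by_cases him : ∃ u : X → ℝ, Measurable u ∧ ∀ᵐ x ∂μ, (F x).im = u (T x) - u x
    · obtain ⟨u, hu, hu'⟩ := hre
      obtain ⟨v, hv, hv'⟩ := him
      refine absurd ⟨fun x => (u x : ℂ) + v x * Complex.I, by fun_prop, ?_⟩ hcob
      filter_upwards [hu', hv'] with x h1 h2
      apply Complex.ext <;> simp [h1, h2]
    · exact key Complex.imLm Complex.measurable_im Complex.abs_im_le_norm him
  · exact key Complex.reLm Complex.measurable_re Complex.abs_re_le_norm hre

/-! ### Second moments and averaging in time. -/

/-- The variance of the number of sets `B i` containing a point is nonnegative. Applied both to time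
translates and to space translates. -/
theorem MeasureTheory.sq_sum_measureReal_le {X ι : Type*} [MeasurableSpace X] {μ : Measure X}
    [IsProbabilityMeasure μ] (s : Finset ι) {B : ι → Set X} (hB : ∀ i, MeasurableSet (B i)) :
    (∑ i ∈ s, μ.real (B i)) ^ 2 ≤ ∑ i ∈ s, ∑ j ∈ s, μ.real (B i ∩ B j) := by
  set f : X → ℝ := fun x => ∑ i ∈ s, (B i).indicator 1 x with hf
  have hint : ∀ D : Set X, MeasurableSet D → Integrable (D.indicator (1 : X → ℝ)) μ := fun D hD =>
    (integrable_const (1 : ℝ)).indicator hD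
  have hf1 : ∫ x, f x ∂μ = ∑ i ∈ s, μ.real (B i) := by
    rw [hf, integral_finsetSum _ fun i _ => hint _ (hB i)]
    simp [integral_indicator_one, hB]
  have hsq : (fun x => f x ^ 2) = fun x => ∑ i ∈ s, ∑ j ∈ s, (B i ∩ B j).indicator 1 x := by
    ext x
    simp only [hf, sq, Finset.sum_mul_sum, Set.inter_indicator_one, Pi.mul_apply]
  have hf2 : ∫ x, f x ^ 2 ∂μ = ∑ i ∈ s, ∑ j ∈ s, μ.real (B i ∩ B j) := by
    rw [hsq, integral_finsetSum _ fun i _ =>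
      integrable_finsetSum _ fun j _ => hint _ ((hB i).inter (hB j))]
    refine Finset.sum_congr rfl fun i _ => ?_
    rw [integral_finsetSum _ fun j _ => hint _ ((hB i).inter (hB j))]
    exact Finset.sum_congr rfl fun j _ => integral_indicator_one ((hB i).inter (hB j))
  have hi1 : Integrable f μ := integrable_finsetSum _ fun i _ => hint _ (hB i)
  have hi2 : Integrable (fun x => f x ^ 2) μ := by
    rw [hsq]
    exact integrable_finsetSum _ fun i _ =>
      integrable_finsetSum _ fun j _ => hint _ ((hB i).inter (hB j))
  have hnonneg : 0 ≤ ∫ x, (f x - ∫ y, f y ∂μ) ^ 2 ∂μ := integral_nonneg fun x => sq_nonneg _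
  have hexp : ∫ x, (f x - ∫ y, f y ∂μ) ^ 2 ∂μ = ∫ x, f x ^ 2 ∂μ - (∫ x, f x ∂μ) ^ 2 := by
    set c := ∫ y, f y ∂μ with hc
    have : (fun x => (f x - c) ^ 2) = fun x => (f x ^ 2 - 2 * c * f x) + c ^ 2 := by
      ext x; ring
    have hi3 : Integrable (fun x => f x ^ 2 - 2 * c * f x) μ := hi2.sub (hi1.const_mul _)
    rw [this, integral_add hi3 (integrable_const _),
      integral_sub hi2 (hi1.const_mul _), integral_const_mul, ← hc]
    simp
    ring
  rw [← hf1, ← hf2]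
  linarith

/-- For fixed `i`, each distance occurs at most once on either side of `i`. -/
theorem Finset.sum_range_sum_range_dist_le {a : ℕ → ℝ} (ha : ∀ m, 0 ≤ a m) (M : ℕ) :
    ∑ i ∈ range M, ∑ j ∈ range M, a (Nat.dist i j) ≤ 2 * M * ∑ m ∈ range M, a m := by
  have h : ∀ i ∈ range M, ∑ j ∈ range M, a (Nat.dist i j) ≤ 2 * ∑ m ∈ range M, a m := by
    intro i hi
    rw [← Finset.sum_filter_add_sum_filter_not (range M) (fun j => j ≤ i), two_mul]
    have aux : ∀ s : Finset ℕ, s ⊆ range M → Set.InjOn (Nat.dist i) s →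
        ∑ j ∈ s, a (Nat.dist i j) ≤ ∑ m ∈ range M, a m := by
      intro s hs hinj
      rw [← Finset.sum_image (f := a) hinj]
      refine Finset.sum_le_sum_of_subset_of_nonneg (fun m hm => ?_) fun m _ _ => ha m
      obtain ⟨j, hj, rfl⟩ := Finset.mem_image.1 hm
      have := Finset.mem_range.1 (hs hj)
      have := Finset.mem_range.1 hi
      rw [Finset.mem_range]
      unfold Nat.dist
      omega
    refine add_le_add (aux _ (Finset.filter_subset _ _) ?_) (aux _ (Finset.filter_subset _ _) ?_)
    all_goals
      intro x hx y hy hxy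
      simp only [Finset.coe_filter, Set.mem_ofPred_eq] at hx hy
      unfold Nat.dist at hxy
      omega
  refine (Finset.sum_le_sum h).trans_eq ?_
  rw [Finset.sum_const, Finset.card_range, nsmul_eq_mul]
  ring

/-- Averaging the return sets `T⁻ᵐ {‖Sₙ F‖ < C}` bounds the measure of `{‖Sₙ F‖ < C}` by the measures of
the sets on which `Sₘ F` and `Sₘ F ∘ Tⁿ` are close. -/
theorem MeasureTheory.MeasurePreserving.sq_mul_measureReal_norm_birkhoffSum_lt_le {X : Type*}
    [MeasurableSpace X] {μ : Measure X} [IsProbabilityMeasure μ] {T : X → X}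
    (hT : MeasurePreserving T μ μ) {F : X → ℂ} (hF : Measurable F) (C : ℝ) (n M : ℕ) :
    (M * μ.real {x | ‖birkhoffSum T F n x‖ < C}) ^ 2 ≤ 2 * M * ∑ m ∈ Finset.range M,
      μ.real {x | ‖birkhoffSum T F m (T^[n] x) - birkhoffSum T F m x‖ < 2 * C} := by
  set B : Set X := {x | ‖birkhoffSum T F n x‖ < C} with hB
  have hS : ∀ n, Measurable (birkhoffSum T F n) := fun n =>
    Finset.measurable_sum _ fun i _ => hF.comp (hT.iterate i).measurable
  have hBm : MeasurableSet B := measurableSet_lt (hS n).norm measurable_const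
  have h := sq_sum_measureReal_le (μ := μ) (Finset.range M) (B := fun i => T^[i] ⁻¹' B)
    fun i => (hT.iterate i).measurable hBm
  have hcongr : ∀ i, μ.real (T^[i] ⁻¹' B) = μ.real B := fun i =>
    (hT.iterate i).measureReal_preimage hBm.nullMeasurableSet
  simp only [hcongr, Finset.sum_const, Finset.card_range, nsmul_eq_mul] at h
  refine h.trans (le_trans ?_ (Finset.sum_range_sum_range_dist_le (fun m => measureReal_nonneg) M))
  have hpair : ∀ i m, μ.real (T^[i] ⁻¹' B ∩ T^[i + m] ⁻¹' B) ≤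
      μ.real {x | ‖birkhoffSum T F m (T^[n] x) - birkhoffSum T F m x‖ < 2 * C} := by
    intro i m
    have : T^[i] ⁻¹' B ∩ T^[i + m] ⁻¹' B = T^[i] ⁻¹' (B ∩ T^[m] ⁻¹' B) := by
      rw [Set.preimage_inter, ← Set.preimage_comp, ← Function.iterate_add, add_comm]
    rw [this, (hT.iterate i).measureReal_preimage
      (hBm.inter ((hT.iterate m).measurable hBm)).nullMeasurableSet]
    refine measureReal_mono ?_
    rintro x ⟨hx1, hx2⟩
    -- Splitting the sum of length `m + n` in two ways exchanges the roles of `m` and `n`.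
    have h1 := birkhoffSum_add T F m n x
    have h2 := birkhoffSum_add T F n m x
    rw [add_comm m n, h2] at h1
    have h3 : birkhoffSum T F m (T^[n] x) - birkhoffSum T F m x =
        birkhoffSum T F n (T^[m] x) - birkhoffSum T F n x := by linear_combination h1
    simp only [hB, Set.mem_preimage, Set.mem_ofPred_eq] at hx1 hx2 ⊢
    rw [h3]
    exact (norm_sub_le _ _).trans_lt (by linarith)
  refine Finset.sum_le_sum fun i _ => Finset.sum_le_sum fun j _ => ?_
  rcases le_total i j with hij | hij
  · obtain ⟨m, rfl⟩ := Nat.exists_eq_add_of_le hij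
    simpa [Nat.dist] using hpair i m
  · obtain ⟨m, rfl⟩ := Nat.exists_eq_add_of_le hij
    rw [Set.inter_comm]
    simpa [Nat.dist] using hpair j m

/-! ### Translations of the torus and shearing by `Tⁿ`. -/

/-- The projection `ℝ^d → (ℝ/ℤ)^d`. -/
def UnitAddTorus.ofReal {d : ℕ} (w : Fin d → ℝ) : UnitAddTorus (Fin d) := fun j => (w j : UnitAddCircle)

namespace UnitAddTorus

variable {d : ℕ}

theorem ofReal_add (v w : Fin d → ℝ) : ofReal (v + w) = ofReal v + ofReal w := by
  ext j
  simp [ofReal]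

theorem ofReal_zero : ofReal (0 : Fin d → ℝ) = 0 := by
  ext j
  simp [ofReal]

theorem continuous_ofReal : Continuous (ofReal : (Fin d → ℝ) → UnitAddTorus (Fin d)) := by
  unfold ofReal
  exact continuous_pi fun j => continuous_quotient_mk'.comp (continuous_apply j)

theorem measurePreserving_add_right (y : UnitAddTorus (Fin d)) :
    MeasurePreserving (fun x : UnitAddTorus (Fin d) => x + y) :=
  MeasureTheory.measurePreserving_add_right volume y

theorem eventually_norm_sub_lt {h : UnitAddTorus (Fin d) → ℂ} (hh : Continuous h) {ε : ℝ}
    (hε : 0 < ε) : ∀ᶠ w in 𝓝 (0 : Fin d → ℝ), ∀ x, ‖h (x + ofReal w) - h x‖ < ε := by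
  have hu := CompactSpace.uniformContinuous_of_continuous hh
  rw [Metric.uniformContinuous_iff] at hu
  obtain ⟨δ, hδ, hu⟩ := hu ε hε
  have hc : Tendsto (ofReal : (Fin d → ℝ) → UnitAddTorus (Fin d)) (𝓝 0) (𝓝 0) := by
    simpa [ofReal_zero] using (continuous_ofReal (d := d)).tendsto 0
  filter_upwards [hc.eventually (Metric.ball_mem_nhds 0 hδ)] with w hw x
  rw [← dist_eq_norm]
  apply hu
  simpa [dist_eq_norm] using hw

end UnitAddTorus

open UnitAddTorus

section SkewTranslation

variable {d : ℕ} {A : Matrix (Fin d) (Fin d) ℤ} {b : UnitAddTorus (Fin d)}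

theorem skewTranslation_add_ofReal (x : UnitAddTorus (Fin d)) (w : Fin d → ℝ) :
    skewTranslation A b (x + ofReal w) =
      skewTranslation A b x + ofReal (Matrix.vecMul w (A.map (Int.cast : ℤ → ℝ))) := by
  ext j
  have : ((∑ i, w i * (A i j : ℝ) : ℝ) : UnitAddCircle) = ∑ i, A i j • (w i : UnitAddCircle) := by
    rw [← QuotientAddGroup.mk'_apply, map_sum]
    refine Finset.sum_congr rfl fun i _ => ?_
    rw [mul_comm, ← zsmul_eq_mul, map_zsmul]
    rfl
  simp only [skewTranslation, ofReal, Pi.add_apply, smul_add, Finset.sum_add_distrib, Matrix.vecMul,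
    dotProduct, Matrix.map_apply, this]
  abel

theorem iterate_skewTranslation_add_ofReal (n : ℕ) (x : UnitAddTorus (Fin d)) (w : Fin d → ℝ) :
    (skewTranslation A b)^[n] (x + ofReal w) = (skewTranslation A b)^[n] x +
      ofReal (Matrix.vecMul w (A.map (Int.cast : ℤ → ℝ) ^ n)) := by
  induction n with
  | zero => simp
  | succ n ih =>
    rw [Function.iterate_succ_apply', ih, Function.iterate_succ_apply', skewTranslation_add_ofReal,
      Matrix.vecMul_vecMul, pow_succ]

theorem continuous_skewTranslation : Continuous (skewTranslation A b) := by
  unfold skewTranslation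
  fun_prop

theorem tendsto_choose_div_choose {m k : ℕ} (hmk : m < k) :
    Tendsto (fun n : ℕ => (n.choose m : ℝ) / n.choose k) atTop (𝓝 0) := by
  have h : (fun n : ℕ => (n : ℝ) ^ m) =o[atTop] fun n : ℕ => (n : ℝ) ^ k :=
    (Asymptotics.isLittleO_pow_pow_atTop_of_lt hmk).comp_tendsto tendsto_natCast_atTop_atTop
  exact (((isTheta_choose m).isBigO.trans_isLittleO h).trans_isBigO
    (isTheta_choose k).isBigO_symm).tendsto_div_nhds_zero

/-- Shearing: real vectors `wₙ → 0` with `wₙ Aⁿ → t e`, for `e` in the image of `(A - 1)^k`. -/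
theorem exists_tendsto_vecMul_pow {B : Matrix (Fin d) (Fin d) ℝ} {k : ℕ} (hk : 0 < k)
    {v e : Fin d → ℝ} (hv : Matrix.vecMul v ((B - 1) ^ k) = e)
    (hv' : Matrix.vecMul v ((B - 1) ^ (k + 1)) = 0) (t : ℝ) :
    ∃ w : ℕ → Fin d → ℝ, Tendsto w atTop (𝓝 0) ∧
      Tendsto (fun n => Matrix.vecMul (w n) (B ^ n)) atTop (𝓝 (t • e)) := by
  have hchoose : ∀ {m}, m < k → Tendsto (fun n : ℕ => (n.choose m : ℝ) / n.choose k) atTop (𝓝 0) :=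
    tendsto_choose_div_choose
  have hzero : ∀ m, k < m → Matrix.vecMul v ((B - 1) ^ m) = 0 := by
    intro m hm
    obtain ⟨j, rfl⟩ := Nat.exists_eq_add_of_le hm
    rw [pow_add, ← Matrix.vecMul_vecMul, hv', Matrix.zero_vecMul]
  have hexp : ∀ n, k ≤ n → Matrix.vecMul v (B ^ n) =
      ∑ m ∈ Finset.range (k + 1), (n.choose m : ℝ) • Matrix.vecMul v ((B - 1) ^ m) := by
    intro n hn
    have hB : B ^ n = ∑ m ∈ Finset.range (n + 1), (n.choose m : ℝ) • (B - 1) ^ m := by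
      conv_lhs => rw [← sub_add_cancel B 1]
      rw [(Commute.one_right (B - 1)).add_pow]
      refine Finset.sum_congr rfl fun m _ => ?_
      rw [one_pow, mul_one, ← nsmul_eq_mul', Nat.cast_smul_eq_nsmul]
    rw [hB, Matrix.vecMul_sum]
    simp only [Matrix.vecMul_smul]
    refine (Finset.sum_subset (Finset.range_subset_range.2 (by omega)) fun m _ hm => ?_).symm
    rw [hzero m (by simpa using hm), smul_zero]
  -- In the binomial expansion of `v Bⁿ` around `1`, the terms beyond `k` vanish and the `k`-th
  -- dominates; dividing by its coefficient isolates `e`. For `n < k` the coefficient is `0` and so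
  -- is `wₙ`, which is harmless.
  refine ⟨fun n => (t * (1 / (n.choose k : ℝ))) • v, ?_, ?_⟩
  · have := ((hchoose hk).const_mul t).smul_const v
    simpa using this
  · have hlim : Tendsto (fun n : ℕ => t • ∑ m ∈ Finset.range (k + 1),
        ((n.choose m : ℝ) / n.choose k) • Matrix.vecMul v ((B - 1) ^ m)) atTop (𝓝 (t • e)) := by
      refine Tendsto.const_smul ?_ t
      simp only [Finset.sum_range_succ]
      have h1 : Tendsto (fun n : ℕ => ∑ m ∈ Finset.range k,
          ((n.choose m : ℝ) / n.choose k) • Matrix.vecMul v ((B - 1) ^ m)) atTop (𝓝 0) := by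
        have := tendsto_finsetSum (Finset.range k) fun m hm =>
          (hchoose (Finset.mem_range.1 hm)).smul_const (Matrix.vecMul v ((B - 1) ^ m))
        simpa using this
      have h2 : Tendsto (fun n : ℕ => ((n.choose k : ℝ) / n.choose k) •
          Matrix.vecMul v ((B - 1) ^ k)) atTop (𝓝 e) := by
        refine tendsto_const_nhds.congr' ?_
        filter_upwards [eventually_ge_atTop k] with n hn
        have : (n.choose k : ℝ) ≠ 0 := by exact_mod_cast (Nat.choose_pos hn).ne'
        rw [div_self this, one_smul, hv]
      simpa using h1.add h2
    refine hlim.congr' ?_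
    filter_upwards [eventually_ge_atTop k] with n hn
    rw [Matrix.smul_vecMul, hexp n hn, mul_smul]
    congr 1
    rw [Finset.smul_sum]
    refine Finset.sum_congr rfl fun m _ => ?_
    rw [smul_smul]
    congr 1
    ring

/-- If `Tⁿ` shears small translations into the translation by `t`, then `h ∘ Tⁿ` may be replaced
by `h (Tⁿ x + t)` when comparing with `h`. -/
theorem eventually_measureReal_norm_sub_lt_le {h : UnitAddTorus (Fin d) → ℂ}
    (hh : Continuous h) {C : ℝ} (hC : 0 < C) {w : ℕ → Fin d → ℝ} {y : Fin d → ℝ}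
    (hw : Tendsto w atTop (𝓝 0))
    (hwy : Tendsto (fun n => Matrix.vecMul (w n) (A.map (Int.cast : ℤ → ℝ) ^ n)) atTop (𝓝 y)) :
    ∀ᶠ n in atTop, volume.real {x | ‖h ((skewTranslation A b)^[n] x) - h x‖ < 2 * C} ≤
      volume.real {x | ‖h ((skewTranslation A b)^[n] x + ofReal y) - h x‖ < 3 * C} := by
  -- Two approximations cost `C/2` each, turning `2C` into `3C`.
  have hev := eventually_norm_sub_lt hh (half_pos hC)
  have hwy' := hwy.sub_const y
  rw [sub_self] at hwy'
  filter_upwards [hw.eventually hev, hwy'.eventually hev] with n h1 h2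
  have hT : Continuous ((skewTranslation A b)^[n]) := continuous_skewTranslation.iterate n
  have hmeas : MeasurableSet {x | ‖h ((skewTranslation A b)^[n] x) - h x‖ < 2 * C} :=
    (isOpen_lt (by fun_prop) continuous_const).measurableSet
  rw [← (UnitAddTorus.measurePreserving_add_right (ofReal (w n))).measureReal_preimage
    hmeas.nullMeasurableSet]
  refine measureReal_mono fun x hx => ?_
  simp only [Set.mem_preimage, Set.mem_ofPred_eq, iterate_skewTranslation_add_ofReal] at hx ⊢
  set z := (skewTranslation A b)^[n] x
  set u := Matrix.vecMul (w n) (A.map (Int.cast : ℤ → ℝ) ^ n)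
  have hzu : z + ofReal u = z + ofReal y + ofReal (u - y) := by
    rw [add_assoc, ← ofReal_add, add_sub_cancel]
  have h2' := h2 (z + ofReal y)
  rw [← hzu] at h2'
  have h1' := h1 x
  have : h (z + ofReal y) - h x = (h (z + ofReal u) - h (x + ofReal (w n))) -
    (h (z + ofReal u) - h (z + ofReal y)) + (h (x + ofReal (w n)) - h x) := by ring
  rw [this]
  refine (norm_add_le _ _).trans_lt ?_
  have := norm_sub_le (h (z + ofReal u) - h (x + ofReal (w n))) (h (z + ofReal u) - h (z + ofReal y))
  linarith

end SkewTranslation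

/-! ### Trigonometric polynomials and coboundaries under translation. -/

/-- Writing `p - p(1) = (X - 1) q` gives `-p(1) v = q(R)(R v - v)`, which lies in `S`. -/
theorem Submodule.mem_of_aeval_eq_zero {K V : Type*} [Field K] [AddCommGroup V] [Module K V]
    {R : Module.End K V} {S : Submodule K V} (hS : ∀ v ∈ S, R v ∈ S) {v : V} (hv : R v - v ∈ S)
    {p : Polynomial K} (hp : Polynomial.aeval R p v = 0) (hp1 : p.eval 1 ≠ 0) : v ∈ S := by
  obtain ⟨q, hq⟩ := Polynomial.X_sub_C_dvd_sub_C_eval (a := (1 : K)) (p := p)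
  have hmem : ∀ (q : Polynomial K), ∀ w ∈ S, Polynomial.aeval R q w ∈ S := by
    intro q w hw
    rw [Polynomial.aeval_eq_sum_range, LinearMap.sum_apply]
    refine S.sum_mem fun i _ => S.smul_mem _ ?_
    clear * - hS hw
    induction i with
    | zero => simpa using hw
    | succ i ih =>
      rw [pow_succ', Module.End.mul_apply]
      exact hS _ ih
  have h := hmem q _ hv
  have h2 : Polynomial.aeval R q (R v - v) = Polynomial.aeval R (p - Polynomial.C (p.eval 1)) v := by
    rw [hq, mul_comm, map_mul]
    simp
  rw [h2, map_sub, LinearMap.sub_apply, hp, zero_sub, Polynomial.aeval_C, S.neg_mem_iff,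
    Module.algebraMap_end_apply] at h
  exact (S.smul_mem_iff hp1).1 h

namespace UnitAddTorus

variable {d : ℕ}

theorem mFourier_apply_add (l : Fin d → ℤ) (x y : UnitAddTorus (Fin d)) :
    mFourier l (x + y) = mFourier l x * mFourier l y := by
  simp [mFourier, fourier_apply, AddCircle.toCircle_add, Finset.prod_mul_distrib]

theorem mFourier_ofReal_smul_single (l : Fin d → ℤ) (i : Fin d) (t : ℝ) :
    mFourier l (ofReal (t • Pi.single i 1)) = fourier (l i) (t : UnitAddCircle) := by
  simp only [mFourier, ContinuousMap.coe_mk]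
  rw [Finset.prod_eq_single i]
  · simp [ofReal]
  · intro j _ hj
    simp [ofReal, hj]
  · simp

theorem fourier_ne_one_of_irrational {n : ℤ} (hn : n ≠ 0) {t : ℝ} (ht : Irrational t) :
    fourier n (t : UnitAddCircle) ≠ 1 := by
  intro h
  rw [fourier_coe_apply, Complex.exp_eq_one_iff] at h
  obtain ⟨m, hm⟩ := h
  have h1 : (n : ℂ) * t = m := by
    have : (2 * Real.pi * Complex.I : ℂ) ≠ 0 := Complex.two_pi_I_ne_zero
    apply mul_left_cancel₀ this
    rw [mul_comm _ (m : ℂ), ← hm]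
    push_cast
    ring
  have h2 : (n : ℝ) * t = m := by exact_mod_cast h1
  exact (ht.intCast_mul hn).ne_int m h2

theorem integral_mFourier_update (l : Fin d → ℤ) (i : Fin d) (x : UnitAddTorus (Fin d)) :
    ∫ y : UnitAddCircle, mFourier l (Function.update x i y) =
      if l i = 0 then mFourier l x else 0 := by
  have h : ∀ y, mFourier l (Function.update x i y) =
      (∏ j ∈ Finset.univ.erase i, fourier (l j) (x j)) * fourier (l i) y := by
    intro y
    simp only [mFourier, ContinuousMap.coe_mk]
    rw [← Finset.prod_erase_mul _ _ (Finset.mem_univ i), Function.update_self]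
    congr 1
    refine Finset.prod_congr rfl fun j hj => ?_
    rw [Function.update_of_ne (Finset.ne_of_mem_erase hj)]
  split_ifs with hl
  · have h' : ∀ y, mFourier l (Function.update x i y) = mFourier l x := by
      intro y
      rw [h, ← Function.update_eq_self i x, h, hl]
      simp
    have : volume.real (Set.univ : Set UnitAddCircle) = 1 := by
      rw [measureReal_def, UnitAddCircle.measure_univ, ENNReal.toReal_one]
    simp [h', this]
  · simp only [h]
    -- Translation by half a period of the character changes its sign.
    rw [integral_const_mul, integral_eq_zero_of_add_right_eq_neg
      (g := ((1 / 2 / (l i : ℝ) : ℝ) : UnitAddCircle)), mul_zero]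
    intro y
    have := fourier_add_half_inv_index hl one_pos y
    simpa using this

end UnitAddTorus

/-- The subspace of measurable coboundaries of `T`. -/
def coboundarySubmodule {d : ℕ} {T : UnitAddTorus (Fin d) → UnitAddTorus (Fin d)} :
    Submodule ℂ (UnitAddTorus (Fin d) → ℂ) where
  carrier := {F | IsMeasurableCoboundary T F}
  add_mem' := by
    rintro F G ⟨u, hu, hF⟩ ⟨v, hv, hG⟩
    refine ⟨u + v, hu.add hv, ?_⟩
    filter_upwards [hF, hG] with x h1 h2
    simp [h1, h2]
    ring
  zero_mem' := ⟨0, measurable_const, by simp⟩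
  smul_mem' := by
    rintro c F ⟨u, hu, hF⟩
    refine ⟨c • u, hu.const_smul c, ?_⟩
    filter_upwards [hF] with x h1
    simp [h1]
    ring

/-- If a trigonometric polynomial has no frequency trivial on `y`, where the translation by `y` commutes
with `T`, then it is a coboundary as soon as its difference with its translate is. -/
theorem isMeasurableCoboundary_of_translate_sub {d : ℕ}
    {T : UnitAddTorus (Fin d) → UnitAddTorus (Fin d)} {y : UnitAddTorus (Fin d)}
    (hTy : ∀ x, T (x + y) = T x + y) (s : Finset (Fin d → ℤ)) (c : (Fin d → ℤ) → ℂ)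
    (hs : ∀ l ∈ s, mFourier l y ≠ 1) {F : UnitAddTorus (Fin d) → ℂ}
    (hF : ∀ x, F x = ∑ l ∈ s, c l * mFourier l x)
    (h : IsMeasurableCoboundary T fun x => F (x + y) - F x) : IsMeasurableCoboundary T F := by
  -- Translation `R` preserves coboundaries, and each frequency is an eigenvector of `R` with
  -- eigenvalue `≠ 1`; so `F` is annihilated by a polynomial in `R` not vanishing at `1`.
  set R : Module.End ℂ (UnitAddTorus (Fin d) → ℂ) := LinearMap.funLeft ℂ ℂ (fun x => x + y) with hR
  refine Submodule.mem_of_aeval_eq_zero (R := R) (S := coboundarySubmodule (T := T)) ?_ h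
    (p := ∏ l ∈ s, (Polynomial.X - Polynomial.C (mFourier l y))) ?_ ?_
  · rintro G ⟨u, hu, hG⟩
    refine ⟨R u, hu.comp (measurable_add_const y), ?_⟩
    filter_upwards [(UnitAddTorus.measurePreserving_add_right y).quasiMeasurePreserving.ae hG]
      with x hx
    simp only [hR, LinearMap.funLeft_apply, hTy] at hx ⊢
    exact hx
  · have hFsum : F = ∑ l ∈ s, c l • (mFourier l : UnitAddTorus (Fin d) → ℂ) := by
      ext x
      simp [hF, Finset.sum_apply]
    rw [hFsum, map_sum]
    refine Finset.sum_eq_zero fun l hl => ?_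
    rw [map_smul, ← Finset.prod_erase_mul _ _ hl, map_mul, Module.End.mul_apply]
    have : Polynomial.aeval R (Polynomial.X - Polynomial.C (mFourier l y))
        (mFourier l : UnitAddTorus (Fin d) → ℂ) = 0 := by
      ext x
      simp [hR, LinearMap.funLeft_apply, mFourier_apply_add, Module.algebraMap_end_apply]
      ring
    rw [this, map_zero, smul_zero]
  · rw [Polynomial.eval_prod]
    refine Finset.prod_ne_zero_iff.2 fun l hl => ?_
    simp only [Polynomial.eval_sub, Polynomial.eval_X, Polynomial.eval_C]
    exact sub_ne_zero.2 (hs l hl).symm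

/-- A trigonometric polynomial with zero average in the coordinate `i` has no frequency `l` with
`l i = 0`. -/
theorem IsTrigPolynomial.exists_eq_sum_of_hasZeroAverage {𝕜 : Type*} [RCLike 𝕜] {d : ℕ}
    {Ψ : UnitAddTorus (Fin d) → 𝕜} (hΨ : IsTrigPolynomial Ψ) {i : Fin d} (h0 : HasZeroAverage i Ψ) :
    ∃ (s : Finset (Fin d → ℤ)) (c : (Fin d → ℤ) → ℂ), (∀ l ∈ s, l i ≠ 0) ∧
      ∀ x, RCLike.map 𝕜 ℂ (Ψ x) = ∑ l ∈ s, c l * mFourier l x := by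
  classical
  obtain ⟨c, hc⟩ := hΨ
  simp only [Finsupp.sum] at hc
  refine ⟨c.support.filter fun l => l i ≠ 0, c, fun l hl => (Finset.mem_filter.1 hl).2, fun x => ?_⟩
  have hcont : Continuous fun x => RCLike.map 𝕜 ℂ (Ψ x) := by
    simp only [hc]
    fun_prop
  have hΨc : Continuous Ψ := by
    -- `RCLike.map ℂ 𝕜` is a continuous left inverse of the inclusion; for `𝕜 = ℝ` it is the real
    -- part.
    have : Ψ = fun x => RCLike.map ℂ 𝕜 (RCLike.map 𝕜 ℂ (Ψ x)) := by
      ext x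
      simp
    rw [this]
    exact (RCLike.map ℂ 𝕜).continuous.comp hcont
  have hint : ∫ y : UnitAddCircle, RCLike.map 𝕜 ℂ (Ψ (Function.update x i y)) = 0 := by
    rw [ContinuousLinearMap.integral_comp_comm, h0 x, map_zero]
    exact (hΨc.comp (continuous_const.update i continuous_id)).integrable_of_hasCompactSupport
      (HasCompactSupport.of_compactSpace _)
  simp only [hc] at hint
  have hterm : ∀ l ∈ c.support,
      Integrable fun y : UnitAddCircle => c l * mFourier l (Function.update x i y) := fun l _ =>
    Continuous.integrable_of_hasCompactSupport
      (continuous_const.mul ((mFourier l).continuous.comp (continuous_const.update i continuous_id)))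
      (HasCompactSupport.of_compactSpace _)
  rw [integral_finsetSum _ hterm] at hint
  simp only [integral_const_mul, integral_mFourier_update, mul_ite, mul_zero] at hint
  -- The frequencies with `l i = 0` sum to the average over the coordinate `i`, which is zero.
  rw [hc, ← Finset.sum_filter_not_add_sum_filter _ (fun l => l i ≠ 0)]
  simp only [not_not, Finset.sum_filter, hint, zero_add]

/-! ### The quantitative estimate. -/

theorem birkhoffSum_translate_sub {X M : Type*} [AddCommGroup X] [AddCommGroup M] {T : X → X} {y : X}
    (hTy : ∀ x, T (x + y) = T x + y) (F : X → M) (m : ℕ) (x : X) :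
    birkhoffSum T (fun x => F (x + y) - F x) m x =
      birkhoffSum T F m (x + y) - birkhoffSum T F m x := by
  have h : ∀ k, T^[k] (x + y) = T^[k] x + y := by
    intro k
    induction k with
    | zero => rfl
    | succ k ih => rw [Function.iterate_succ_apply', ih, hTy, Function.iterate_succ_apply']
  simp [birkhoffSum, h]

section SkewTranslation

variable {d : ℕ} {A : Matrix (Fin d) (Fin d) ℤ} {b : UnitAddTorus (Fin d)}

/-- The averaging in space: each of the `Q` sheared sets `G i` has measure at least that of the
original set, and on `G i ∩ G j` the common term `S_m F(x)` cancels, leaving a sum of `F(· + (i -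
j)θe) - F` at a translate of `Tⁿ x`. -/
theorem eventually_sq_mul_measureReal_norm_sub_lt_le
    [IsProbabilityMeasure (volume : Measure (UnitAddTorus (Fin d)))]
    (hT : MeasurePreserving (skewTranslation A b)) {e : Fin d → ℝ}
    (he : Matrix.vecMul e (A.map (Int.cast : ℤ → ℝ)) = e)
    (hshear : ∀ t : ℝ, ∃ w : ℕ → Fin d → ℝ, Tendsto w atTop (𝓝 0) ∧
      Tendsto (fun n => Matrix.vecMul (w n) (A.map (Int.cast : ℤ → ℝ) ^ n)) atTop (𝓝 (t • e)))
    {F : UnitAddTorus (Fin d) → ℂ} (hF : Continuous F) {C : ℝ} (hC : 0 < C) (θ : ℝ) (m Q : ℕ) :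
    ∀ᶠ n in atTop, (Q * volume.real {x | ‖birkhoffSum (skewTranslation A b) F m
        ((skewTranslation A b)^[n] x) - birkhoffSum (skewTranslation A b) F m x‖ < 2 * C}) ^ 2 ≤
      ∑ i ∈ Finset.range Q, ∑ j ∈ Finset.range Q, volume.real {x | ‖birkhoffSum (skewTranslation A b)
        (fun x => F (x + ofReal ((((i : ℤ) - (j : ℤ) : ℤ) * θ) • e)) - F x) m x‖ < 6 * C} := by
  set T := skewTranslation A b with hTdef
  have hTc : Continuous T := continuous_skewTranslation
  have hS : ∀ {F : UnitAddTorus (Fin d) → ℂ}, Continuous F → Continuous (birkhoffSum T F m) :=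
    fun hF => continuous_finsetSum _ fun i _ => hF.comp (hTc.iterate i)
  have hTe : ∀ (t : ℝ) x, T (x + ofReal (t • e)) = T x + ofReal (t • e) := by
    intro t x
    rw [hTdef, skewTranslation_add_ofReal, Matrix.smul_vecMul, he]
  have hev : ∀ᶠ n in atTop, ∀ i ∈ Finset.range Q,
      volume.real {x | ‖birkhoffSum T F m (T^[n] x) - birkhoffSum T F m x‖ < 2 * C} ≤
      volume.real {x | ‖birkhoffSum T F m (T^[n] x + ofReal ((i * θ) • e)) -
        birkhoffSum T F m x‖ < 3 * C} := by
    rw [Filter.eventually_all_finset]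
    intro i _
    obtain ⟨w, hw, hw'⟩ := hshear (i * θ)
    exact eventually_measureReal_norm_sub_lt_le (hS hF) hC hw hw'
  filter_upwards [hev] with n hn
  set G : ℕ → Set (UnitAddTorus (Fin d)) := fun i =>
    {x | ‖birkhoffSum T F m (T^[n] x + ofReal ((i * θ) • e)) - birkhoffSum T F m x‖ < 3 * C} with hG
  have hTn : Continuous T^[n] := hTc.iterate n
  have hGm : ∀ i, MeasurableSet (G i) := fun i => by
    have h1 : Continuous fun x => birkhoffSum T F m (T^[n] x + ofReal ((i * θ) • e)) :=
      (hS hF).comp (hTn.add continuous_const)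
    exact (isOpen_lt (h1.sub (hS hF)).norm continuous_const).measurableSet
  have h := sq_sum_measureReal_le (μ := volume) (Finset.range Q) hGm
  refine le_trans ?_ (h.trans ?_)
  · refine pow_le_pow_left₀ (by positivity) ?_ 2
    refine le_trans ?_ (Finset.sum_le_sum hn)
    simp
  · refine Finset.sum_le_sum fun i _ => Finset.sum_le_sum fun j _ => ?_
    set y := ofReal ((((i : ℤ) - (j : ℤ) : ℤ) * θ) • e) with hy
    have hsub : G i ∩ G j ⊆ (fun x => T^[n] x + ofReal ((j * θ) • e)) ⁻¹'
        {x | ‖birkhoffSum T (fun x => F (x + y) - F x) m x‖ < 6 * C} := by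
      rintro x ⟨hi, hj⟩
      simp only [hG, Set.mem_ofPred_eq, Set.mem_preimage] at hi hj ⊢
      rw [birkhoffSum_translate_sub (hTe _), add_assoc, ← ofReal_add, ← add_smul]
      have : (j : ℝ) * θ + ((i : ℤ) - (j : ℤ) : ℤ) * θ = i * θ := by
        push_cast
        ring
      rw [this]
      rw [← sub_sub_sub_cancel_right _ _ (birkhoffSum T F m x)]
      exact (norm_sub_le _ _).trans_lt (by linarith)
    refine (measureReal_mono hsub).trans_eq ?_
    refine ((UnitAddTorus.measurePreserving_add_right (ofReal ((j * θ) • e))).comp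
      (hT.iterate n)).measureReal_preimage ?_
    have hFy : Continuous fun x => F (x + y) - F x := by fun_prop
    exact (isOpen_lt (hS hFy).norm continuous_const).measurableSet.nullMeasurableSet

/-- The parameters are chosen in the order `η`, `Q`, `M`, `n`; the shearing is needed only for the
finitely many `m < M` and `i < Q`. -/
theorem tendsto_measureReal_norm_birkhoffSum_lt
    [IsProbabilityMeasure (volume : Measure (UnitAddTorus (Fin d)))]
    (hT : Ergodic (skewTranslation A b) volume) {e : Fin d → ℝ}
    (he : Matrix.vecMul e (A.map (Int.cast : ℤ → ℝ)) = e)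
    (hshear : ∀ t : ℝ, ∃ w : ℕ → Fin d → ℝ, Tendsto w atTop (𝓝 0) ∧
      Tendsto (fun n => Matrix.vecMul (w n) (A.map (Int.cast : ℤ → ℝ) ^ n)) atTop (𝓝 (t • e)))
    {F : UnitAddTorus (Fin d) → ℂ} (hF : Continuous F) {θ : ℝ}
    (hcob : ∀ q : ℤ, q ≠ 0 → ¬ IsMeasurableCoboundary (skewTranslation A b)
      fun x => F (x + ofReal ((q * θ) • e)) - F x) {C : ℝ} (hC : 0 < C) :
    Tendsto (fun n => volume.real {x | ‖birkhoffSum (skewTranslation A b) F n x‖ < C})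
      atTop (𝓝 0) := by
  set T := skewTranslation A b with hTdef
  set c : ℤ → ℕ → ℝ := fun q m => volume.real
    {x | ‖birkhoffSum T (fun x => F (x + ofReal ((q * θ) • e)) - F x) m x‖ < 6 * C} with hc
  have hc1 : ∀ q m, c q m ≤ 1 := fun q m => measureReal_le_one
  have havg : ∀ q, q ≠ 0 → Tendsto (fun M : ℕ => (M : ℝ)⁻¹ * ∑ m ∈ Finset.range M, c q m)
      atTop (𝓝 0) := fun q hq =>
    hT.tendsto_average_measureReal_norm_birkhoffSum_lt (by fun_prop : Continuous _).measurable
      (hcob q hq) (by positivity)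
  suffices h : ∀ η > 0, ∀ᶠ n in atTop, volume.real {x | ‖birkhoffSum T F n x‖ < C} < η by
    refine tendsto_order.2 ⟨fun η hη => Eventually.of_forall fun n => hη.trans_le measureReal_nonneg, h⟩
  intro η hη
  -- The estimates end in `a⁴ ≤ 4 (1/Q + ε) < 8ε`, below `η⁴ = 16ε`.
  set ε := η ^ 4 / 16 with hε
  have hε0 : 0 < ε := by positivity
  obtain ⟨Q', hQ'⟩ := exists_nat_one_div_lt hε0
  set Q := Q' + 1 with hQ
  have hQε : 1 / (Q : ℝ) < ε := by simpa [hQ] using hQ'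
  have hQ0 : (0 : ℝ) < Q := by simp only [hQ]; positivity
  have hMev : ∀ᶠ M : ℕ in atTop, ∀ i ∈ Finset.range Q, ∀ j ∈ Finset.range Q, i ≠ j →
      (M : ℝ)⁻¹ * ∑ m ∈ Finset.range M, c ((i : ℤ) - (j : ℤ)) m < ε := by
    rw [Filter.eventually_all_finset]
    intro i _
    rw [Filter.eventually_all_finset]
    intro j _
    by_cases hij : i = j
    · exact Eventually.of_forall fun M h => absurd hij h
    · filter_upwards [(havg ((i : ℤ) - (j : ℤ)) (by omega)).eventually_lt_const hε0] with M hM _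
      exact hM
  obtain ⟨M, hM, hM1⟩ := (hMev.and (eventually_ge_atTop 1)).exists
  have hM0 : (0 : ℝ) < M := by exact_mod_cast hM1
  have hcsum : ∀ i ∈ Finset.range Q, ∀ j ∈ Finset.range Q,
      ∑ m ∈ Finset.range M, c ((i : ℤ) - (j : ℤ)) m ≤ M * ((if i = j then 1 else 0) + ε) := by
    intro i hi j hj
    split_ifs with hij
    -- On the diagonal the function is zero, so only the trivial bound `1` is available.
    · refine (Finset.sum_le_card_nsmul _ _ 1 fun m _ => hc1 _ _).trans ?_
      rw [Finset.card_range, nsmul_eq_mul]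
      gcongr
      linarith
    · have := hM i hi j hj hij
      rw [inv_mul_lt_iff₀ hM0] at this
      linarith
  have hctotal : ∑ i ∈ Finset.range Q, ∑ j ∈ Finset.range Q, ∑ m ∈ Finset.range M,
      c ((i : ℤ) - (j : ℤ)) m ≤ M * (Q + Q ^ 2 * ε) := by
    refine (Finset.sum_le_sum fun i hi => Finset.sum_le_sum fun j hj => hcsum i hi j hj).trans_eq ?_
    have : ∀ i ∈ Finset.range Q, ∑ j ∈ Finset.range Q, (M : ℝ) * ((if i = j then 1 else 0) + ε) =
        M * (1 + Q * ε) := by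
      intro i hi
      rw [← Finset.mul_sum, Finset.sum_add_distrib, Finset.sum_ite_eq, if_pos hi]
      simp
    rw [Finset.sum_congr rfl this, Finset.sum_const, Finset.card_range, nsmul_eq_mul]
    ring
  have hnev := (Filter.eventually_all_finset (Finset.range M)).2 fun m _ =>
    eventually_sq_mul_measureReal_norm_sub_lt_le hT.toMeasurePreserving he hshear hF hC θ m Q
  filter_upwards [hnev] with n hn
  set a := volume.real {x | ‖birkhoffSum T F n x‖ < C} with ha
  set D : ℕ → ℝ := fun m => volume.real
    {x | ‖birkhoffSum T F m (T^[n] x) - birkhoffSum T F m x‖ < 2 * C} with hD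
  have h1 : (M * a) ^ 2 ≤ 2 * M * ∑ m ∈ Finset.range M, D m :=
    hT.toMeasurePreserving.sq_mul_measureReal_norm_birkhoffSum_lt_le hF.measurable C n M
  have h2 : (∑ m ∈ Finset.range M, D m) ^ 2 ≤ M * ∑ m ∈ Finset.range M, D m ^ 2 := by
    simpa using sq_sum_le_card_mul_sum_sq (s := Finset.range M) (f := D)
  have h3 : Q ^ 2 * ∑ m ∈ Finset.range M, D m ^ 2 ≤ M * (Q + Q ^ 2 * ε) := by
    refine le_trans ?_ hctotal
    rw [Finset.mul_sum]
    simp only [← mul_pow]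
    refine (Finset.sum_le_sum hn).trans_eq ?_
    rw [Finset.sum_comm]
    exact Finset.sum_congr rfl fun i _ => Finset.sum_comm
  set S1 := ∑ m ∈ Finset.range M, D m
  set S2 := ∑ m ∈ Finset.range M, D m ^ 2
  have h4 : (M * a) ^ 4 ≤ 4 * M ^ 3 * S2 := by
    calc (M * a) ^ 4 = ((M * a) ^ 2) ^ 2 := by ring
      _ ≤ (2 * M * S1) ^ 2 := pow_le_pow_left₀ (by positivity) h1 2
      _ = 4 * M ^ 2 * S1 ^ 2 := by ring
      _ ≤ 4 * M ^ 2 * (M * S2) := by gcongr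
      _ = 4 * M ^ 3 * S2 := by ring
  have h5 : a ^ 4 * (M ^ 4 * Q ^ 2) ≤ (4 * (1 / Q + ε)) * (M ^ 4 * Q ^ 2) := by
    calc a ^ 4 * (M ^ 4 * Q ^ 2) = Q ^ 2 * (M * a) ^ 4 := by ring
      _ ≤ Q ^ 2 * (4 * M ^ 3 * S2) := by gcongr
      _ = 4 * M ^ 3 * (Q ^ 2 * S2) := by ring
      _ ≤ 4 * M ^ 3 * (M * (Q + Q ^ 2 * ε)) := by gcongr
      _ = (4 * (1 / Q + ε)) * (M ^ 4 * Q ^ 2) := by field_simp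
  have h6 : a ^ 4 < η ^ 4 := by
    have := le_of_mul_le_mul_right h5 (by positivity)
    have h16 : η ^ 4 = 16 * ε := by rw [hε]; ring
    linarith
  exact lt_of_pow_lt_pow_left₀ 4 hη.le h6

end SkewTranslation

/-! ### Passage from `𝕜` to `ℂ` and conclusion. -/

theorem isMeasurableCoboundary_of_map {𝕜 : Type*} [RCLike 𝕜] {d : ℕ}
    {T : UnitAddTorus (Fin d) → UnitAddTorus (Fin d)} {Ψ : UnitAddTorus (Fin d) → 𝕜}
    (h : IsMeasurableCoboundary T fun x => RCLike.map 𝕜 ℂ (Ψ x)) : IsMeasurableCoboundary T Ψ := by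
  obtain ⟨u, hu, hu'⟩ := h
  refine ⟨fun x => RCLike.map ℂ 𝕜 (u x), (RCLike.map ℂ 𝕜).continuous.measurable.comp hu, ?_⟩
  filter_upwards [hu'] with x hx
  rw [← map_sub, ← hx]
  simp

theorem norm_rclikeMap {𝕜 : Type*} [RCLike 𝕜] (z : 𝕜) : ‖RCLike.map 𝕜 ℂ z‖ = ‖z‖ := by
  rw [← sq_eq_sq₀ (norm_nonneg _) (norm_nonneg _), ← RCLike.normSq_eq_def', ← RCLike.normSq_eq_def',
    RCLike.normSq_apply, RCLike.normSq_apply]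
  simp

theorem theorem2p5 {𝕜 : Type*} [RCLike 𝕜] (d : ℕ) (hd : 2 ≤ d)
    (A : Matrix (Fin d) (Fin d) ℤ) (b : UnitAddTorus (Fin d))
    (hA : IsUpperUnipotent A) (hA1 : A ≠ 1)
    (hT : Ergodic (skewTranslation A b) volume)
    (k : ℕ)
    (hEk : imageFiltration A k = Submodule.span ℝ {Pi.single (lastIndex hd) 1})
    (hEk1 : imageFiltration A (k + 1) = ⊥)
    (Ψ : UnitAddTorus (Fin d) → 𝕜)
    (hΨ : IsTrigPolynomial Ψ) (hΨ0 : HasZeroAverage (lastIndex hd) Ψ)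
    (hcob : ¬ IsMeasurableCoboundary (skewTranslation A b) Ψ)
    (C : ℝ) (hC : 1 < C) :
    Tendsto (fun n : ℕ => volume {x | ‖birkhoffSum (skewTranslation A b) Ψ n x‖ < C})
      atTop (𝓝 0) := by
  have hcircle : IsProbabilityMeasure (volume : Measure UnitAddCircle) :=
    ⟨UnitAddCircle.measure_univ⟩
  set e : Fin d → ℝ := Pi.single (lastIndex hd) 1 with he
  set B : Matrix (Fin d) (Fin d) ℝ := A.map (Int.cast : ℤ → ℝ) with hB
  have hvanish : ∀ v, Matrix.vecMul v ((B - 1) ^ (k + 1)) = 0 := fun v => by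
    have : Matrix.vecMul v ((B - 1) ^ (k + 1)) ∈ imageFiltration A (k + 1) := ⟨v, rfl⟩
    rwa [hEk1, Submodule.mem_bot] at this
  obtain ⟨v, hv⟩ : e ∈ imageFiltration A k := by
    rw [hEk]
    exact Submodule.mem_span_singleton_self _
  replace hv : Matrix.vecMul v ((B - 1) ^ k) = e := hv
  -- For `k = 0` the image of `A - 1` would vanish, forcing `A = 1`; without `k > 0` there is no
  -- shearing.
  have hk : 0 < k := by
    rw [pos_iff_ne_zero]
    rintro rfl
    apply hA1
    have hB1 : B - 1 = 0 := by
      ext i j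
      have := congrFun (hvanish (Pi.single i 1)) j
      simpa using this
    ext i j
    have := congrFun (congrFun (sub_eq_zero.1 hB1) i) j
    simp only [hB, Matrix.map_apply, Matrix.one_apply] at this ⊢
    exact_mod_cast this
  have heB : Matrix.vecMul e B = e := by
    have : Matrix.vecMul e (B - 1) = 0 := by
      rw [← hv, Matrix.vecMul_vecMul, ← pow_succ, hvanish]
    rwa [Matrix.vecMul_sub, Matrix.vecMul_one, sub_eq_zero] at this
  obtain ⟨s, c, hs, hF⟩ := hΨ.exists_eq_sum_of_hasZeroAverage hΨ0
  set F : UnitAddTorus (Fin d) → ℂ := fun x => RCLike.map 𝕜 ℂ (Ψ x) with hFdef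
  have hFcont : Continuous F := by
    have : F = fun x => ∑ l ∈ s, c l * mFourier l x := funext hF
    rw [this]
    fun_prop
  -- With `θ = √2`, `q ≠ 0` and every frequency nonzero in the last coordinate, no character of `F`
  -- is trivial on `qθe`.
  have hcob' : ∀ q : ℤ, q ≠ 0 → ¬ IsMeasurableCoboundary (skewTranslation A b)
      fun x => F (x + ofReal ((q * √2) • e)) - F x := by
    intro q hq h
    refine hcob (isMeasurableCoboundary_of_map
      (isMeasurableCoboundary_of_translate_sub (fun x => ?_) s c (fun l hl => ?_) hF h))
    · rw [skewTranslation_add_ofReal, Matrix.smul_vecMul, heB]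
    · rw [he, mFourier_ofReal_smul_single]
      exact fourier_ne_one_of_irrational (hs l hl) (irrational_sqrt_two.intCast_mul hq)
  have hlim := tendsto_measureReal_norm_birkhoffSum_lt hT heB
    (exists_tendsto_vecMul_pow hk hv (hvanish v)) hFcont hcob' (one_pos.trans hC)
  have hset : ∀ n x, ‖birkhoffSum (skewTranslation A b) F n x‖ =
      ‖birkhoffSum (skewTranslation A b) Ψ n x‖ := by
    intro n x
    rw [← norm_rclikeMap (birkhoffSum (skewTranslation A b) Ψ n x), map_birkhoffSum]
    rfl
  simp only [hset] at hlim
  rw [← ENNReal.tendsto_toReal_iff (fun n => measure_ne_top _ _) ENNReal.zero_ne_top]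
  simpa [measureReal_def] using hlim
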